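/- Let $\gamma,\epsilon,\rho\in(0,1)$ with $\gamma$ rational, and let $\gamma=n_1/n_2$ in lowest terms, $n_2>0$. Assume $4\gamma(1-\gamma)>9\rho\epsilon^2$ and $6\rho\le 1$, and put $$k=\left\lceil\frac{1}{n_2}\left(\frac{4\gamma(1-\gamma)}{9\rho\epsilon^2}-1\right)\right\rceil,\qquad N=kn_2-1 .$$ Then $k\ge 1$ and $\lfloor N\gamma\rfloor+1\le N$, and the following holds. Let $y$ be any real random variable whose cumulative distribution function $F(x)=\mathrm{prob}\{y\le x\}$ is continuous, let $y_1,\dots,y_N$ be independent and identically distributed samples of $y$, and let $y_{(1)}\le\dots\le y_{(N)}$ be these samples sorted in ascending order. Then the estimator $\tilde J=y_{(\lfloor N\gamma\rfloor+1)}$ satisfies $$\mathrm{prob}\{|F(\tilde J)-\gamma|\le\epsilon\}\ge 1-\rho .$$ -/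

import Mathlib

open MeasureTheory ProbabilityTheory

/-- The `m`-th order statistic (counted from `1`, ascending, with multiplicity) of a finite
sample `x`: the `m`-th entry of the sample sorted in ascending order. It is meaningful for
`1 ≤ m ≤ N`; outside that range the value is the placeholder `0`. -/
noncomputable def orderStatistic {N : ℕ} (x : Fin N → ℝ) (m : ℕ) : ℝ :=
  if h : 1 ≤ m ∧ m ≤ N then x (Tuple.sort x ⟨m - 1, by omega⟩) else 0

/-- `Y 0, …, Y (N - 1)` are i.i.d. samples of the random variable `yD`: they are mutually
independent under `P` and each of them has the same distribution as `yD` has under `P₀`. -/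
structure IsIIDSample {Ω₀ Ω : Type*} [MeasurableSpace Ω₀] [MeasurableSpace Ω]
    (P₀ : Measure Ω₀) (yD : Ω₀ → ℝ) (P : Measure Ω) {N : ℕ} (Y : Fin N → Ω → ℝ) : Prop where
  indep : iIndepFun Y P
  identDistrib : ∀ i, IdentDistrib (Y i) yD P P₀

/-! For continuous `F`, the value of `F` at the `(a + 1)`-st of `N = a + c + 1` samples has the
Beta(`a + 1`, `c + 1`) law, whose distribution function is a binomial tail. Because `N + 1 = k *
n₂`, its mean is exactly `γ`; its variance is `γ * (1 - γ) / (N + 2)`. The density is unimodal, so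
the Vysochanskij–Petunin inequality `integral_tails_le_of_unimodal` improves Chebyshev's bound by
the factor `4 / 9`. The choice of `k` makes the result at most `ρ`, and `6 * ρ ≤ 1` keeps variance
over `ε ^ 2` below `3 / 8`, where that factor is valid.

A unimodal law is a mixture of uniform laws on intervals ending at the mode. It therefore suffices
that a quadratic dominate the tail indicator in mean on each such interval
(`exists_quadratic_majorant`); integration by parts against `p'` carries this over to `p`. -/

/-! ### Quadratic majorants of the tail indicator -/

/-- The primitive, up to a constant, of the indicator of `{y | 1 ≤ |y|}`. -/
noncomputable def excess (y : ℝ) : ℝ := max (y - 1) 0 + min (y + 1) 0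

lemma excess_neg (y : ℝ) : excess (-y) = -excess y := by
  unfold excess
  rcases le_total (y - 1) 0 with h | h <;> rcases le_total (y + 1) 0 with h' | h' <;>
  rcases le_total (-y - 1) 0 with g | g <;> rcases le_total (-y + 1) 0 with g' | g' <;>
  simp only [max_eq_right, max_eq_left, min_eq_left, min_eq_right, *] <;> linarith

lemma excess_of_one_le {y : ℝ} (h : 1 ≤ y) : excess y = y - 1 := by
  rw [excess, max_eq_left (by linarith), min_eq_right (by linarith)]; ring

lemma excess_of_le_neg_one {y : ℝ} (h : y ≤ -1) : excess y = y + 1 := by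
  rw [excess, max_eq_right (by linarith), min_eq_left (by linarith)]; ring

lemma excess_of_mem {y : ℝ} (h : -1 ≤ y) (h' : y ≤ 1) : excess y = 0 := by
  rw [excess, max_eq_right (by linarith), min_eq_right (by linarith)]; ring

/-- A quadratic `A * (y ^ 2 - b)` dominates the indicator of `{y | 1 ≤ |y|}` in mean on every
interval with endpoint `n`, and gives the constant `4 / 9` for second moments up to `3 / 8`. -/
lemma exists_quadratic_majorant_of_nonneg (n : ℝ) (hn : 0 ≤ n) :
    ∃ A b : ℝ, (∀ t, 0 ≤ t → t ≤ 3 / 8 → A * (t - b) ≤ 4 / 9 * t) ∧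
      ∀ y, 0 ≤ (y - n) * (A * ((y ^ 3 - n ^ 3) / 3 - b * (y - n)) - (excess y - excess n)) := by
  rcases le_total n 1 with h1 | h1
  · have hn2 : n ^ 2 ≤ 1 := by nlinarith
    have hd : 0 < 3 * (3 - 2 * n ^ 2) := by linarith
    -- This `b` gives the primitive of the quadratic a double root at `-n / 2`; this `A` makes `A *
    -- (t - b)` meet `4 / 9 * t` at `t = 3 / 8`.
    refine ⟨4 / (3 * (3 - 2 * n ^ 2)), n ^ 2 / 4, ?_, ?_⟩
    · intro t ht0 ht
      rw [div_mul_eq_mul_div, div_le_iff₀ hd]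
      nlinarith [mul_nonneg (sub_nonneg.2 ht) (sq_nonneg n)]
    · intro y
      rw [excess_of_mem (y := n) (by linarith) h1, sub_zero]
      have key : 4 / (3 * (3 - 2 * n ^ 2)) * ((y ^ 3 - n ^ 3) / 3 - n ^ 2 / 4 * (y - n))
          = (y - n) * (2 * y + n) ^ 2 / (3 * (3 * (3 - 2 * n ^ 2))) := by
        field_simp; ring
      rw [key]
      rcases le_total y (-1) with hy | hy
      · rw [excess_of_le_neg_one hy]
        apply mul_nonneg_of_nonpos_of_nonpos (by linarith)
        rw [sub_nonpos, div_le_iff₀ (by linarith)]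
        obtain ⟨w, rfl⟩ : ∃ w, y = -w := ⟨-y, by ring⟩
        have hw : 1 ≤ w := by linarith
        -- With denominators cleared, the required difference is exactly the sum of these three
        -- terms, an interpolation in `n ^ 2`.
        have e1 : 0 ≤ (1 - n ^ 2) * ((2 * w - 3) ^ 2 * (w + 3)) :=
          mul_nonneg (by linarith) (mul_nonneg (sq_nonneg _) (by linarith))
        have e2 : 0 ≤ n ^ 2 * (4 * ((w - 1) ^ 2 * (w + 2))) :=
          mul_nonneg (sq_nonneg _) (mul_nonneg (by norm_num)
            (mul_nonneg (sq_nonneg _) (by linarith)))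
        have e3 : 0 ≤ n ^ 2 * (1 + n) := by positivity
        nlinarith
      · rcases le_total y 1 with hy' | hy'
        · rw [excess_of_mem hy hy', sub_zero]
          have : (y - n) * ((y - n) * (2 * y + n) ^ 2 / (3 * (3 * (3 - 2 * n ^ 2))))
            = ((y - n) * (2 * y + n)) ^ 2 / (3 * (3 * (3 - 2 * n ^ 2))) := by ring
          rw [this]; positivity
        · rw [excess_of_one_le hy']
          apply mul_nonneg (by linarith)
          rw [sub_nonneg, le_div_iff₀ (by linarith)]
          have e1 : 0 ≤ (1 - n ^ 2) * ((2 * y - 3) ^ 2 * (y + 3)) :=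
            mul_nonneg (by linarith) (mul_nonneg (sq_nonneg _) (by linarith))
          have e2 : 0 ≤ n ^ 2 * (4 * ((y - 1) ^ 2 * (y + 2))) :=
            mul_nonneg (sq_nonneg _) (mul_nonneg (by norm_num)
              (mul_nonneg (sq_nonneg _) (by linarith)))
          have e3 : 0 ≤ n ^ 2 * (1 - n) := mul_nonneg (sq_nonneg _) (by linarith)
          nlinarith
  -- Beyond `n = 1` the coefficients stay frozen at their values there.
  · refine ⟨4 / 3, 1 / 4, fun t _ ht => by linarith, fun y => ?_⟩
    rw [excess_of_one_le h1]
    have hn3 : 0 ≤ (n - 1) ^ 2 * (n + 2) := mul_nonneg (sq_nonneg _) (by linarith)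
    rcases le_total y (-1) with hy | hy
    · rw [excess_of_le_neg_one hy]
      apply mul_nonneg_of_nonpos_of_nonpos (by linarith)
      have : 0 ≤ (-y - 1) ^ 2 * (-y + 2) := mul_nonneg (sq_nonneg _) (by linarith)
      nlinarith
    · rcases le_total y 1 with hy' | hy'
      · rw [excess_of_mem hy hy']
        apply mul_nonneg_of_nonpos_of_nonpos (by linarith)
        have : 0 ≤ (1 - y) * (1 + 2 * y) ^ 2 := mul_nonneg (by linarith) (sq_nonneg _)
        nlinarith
      · rw [excess_of_one_le hy']
        have e : (y - n) * (4 / 3 * ((y ^ 3 - n ^ 3) / 3 - 1 / 4 * (y - n)) - (y - 1 - (n - 1)))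
          = (y - n) ^ 2 * (4 / 9 * (y ^ 2 + y * n + n ^ 2 - 3)) := by ring
        rw [e]
        exact mul_nonneg (sq_nonneg _) (by nlinarith)

lemma exists_quadratic_majorant (n : ℝ) :
    ∃ A b : ℝ, (∀ t, 0 ≤ t → t ≤ 3 / 8 → A * (t - b) ≤ 4 / 9 * t) ∧
      ∀ y, 0 ≤ (y - n) * (A * ((y ^ 3 - n ^ 3) / 3 - b * (y - n)) - (excess y - excess n)) := by
  rcases le_total 0 n with hn | hn
  · exact exists_quadratic_majorant_of_nonneg n hn
  · obtain ⟨A, b, h1, h2⟩ := exists_quadratic_majorant_of_nonneg (-n) (by linarith)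
    refine ⟨A, b, h1, fun y => (h2 (-y)).trans_eq ?_⟩
    rw [excess_neg, excess_neg]; ring

/-! ### The Vysochanskij–Petunin inequality -/

/-- Integration by parts against the excess over a threshold. -/
lemma integral_max_sub_mul_deriv {p p' : ℝ → ℝ} (hp : ∀ x, HasDerivAt p (p' x) x)
    (hp' : Continuous p') {v w : ℝ} (hv0 : 0 ≤ v) (hv1 : v ≤ 1)
    (hvw : ∀ x ∈ Set.Icc (0 : ℝ) 1, max (x - w) 0 = max (x - v) 0) :
    ∫ x in (0 : ℝ)..1, max (x - w) 0 * p' x = max (1 - w) 0 * p 1 - ∫ x in v..1, p x := by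
  have hint : ∀ a b, IntervalIntegrable (fun x => max (x - w) 0 * p' x) volume a b :=
    fun a b => Continuous.intervalIntegrable (by fun_prop) a b
  -- The threshold `w` may lie outside the unit interval; `v` is its truncation, with the same
  -- excess on `[0, 1]`, and marks the kink.
  rw [← intervalIntegral.integral_add_adjacent_intervals (hint 0 v) (hint v 1)]
  have e1 : ∫ x in (0 : ℝ)..v, max (x - w) 0 * p' x = 0 := by
    rw [intervalIntegral.integral_congr (g := fun _ => 0), intervalIntegral.integral_zero]
    intro x hx
    rw [Set.uIcc_of_le hv0] at hx
    simp only
    rw [hvw x ⟨hx.1, hx.2.trans hv1⟩, max_eq_right (by linarith [hx.2]), zero_mul]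
  have e2 : ∫ x in v..1, max (x - w) 0 * p' x = ∫ x in v..1, (x - v) * p' x := by
    apply intervalIntegral.integral_congr
    intro x hx
    rw [Set.uIcc_of_le hv1] at hx
    simp only
    rw [hvw x ⟨hv0.trans hx.1, hx.2⟩, max_eq_left (by linarith [hx.1])]
  rw [e1, e2, intervalIntegral.integral_mul_deriv_eq_deriv_mul (u := fun x => x - v)
    (u' := fun _ => 1) (v := p) (fun x _ => (hasDerivAt_id x).sub_const v) (fun x _ => hp x)
    (by simp) (hp'.intervalIntegrable _ _), hvw 1 (by simp), max_eq_left (by linarith)]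
  simp

lemma integral_min_sub_mul_deriv {p p' : ℝ → ℝ} (hp : ∀ x, HasDerivAt p (p' x) x)
    (hp' : Continuous p') {u w : ℝ} (hu0 : 0 ≤ u) (hu1 : u ≤ 1)
    (huw : ∀ x ∈ Set.Icc (0 : ℝ) 1, min (x - w) 0 = min (x - u) 0) :
    ∫ x in (0 : ℝ)..1, min (x - w) 0 * p' x = -(min (0 - w) 0 * p 0) - ∫ x in (0 : ℝ)..u, p x := by
  have hint : ∀ a b, IntervalIntegrable (fun x => min (x - w) 0 * p' x) volume a b :=
    fun a b => Continuous.intervalIntegrable (by fun_prop) a b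
  rw [← intervalIntegral.integral_add_adjacent_intervals (hint 0 u) (hint u 1)]
  have e1 : ∫ x in u..1, min (x - w) 0 * p' x = 0 := by
    rw [intervalIntegral.integral_congr (g := fun _ => 0), intervalIntegral.integral_zero]
    intro x hx
    rw [Set.uIcc_of_le hu1] at hx
    simp only
    rw [huw x ⟨hu0.trans hx.1, hx.2⟩, min_eq_right (by linarith [hx.1]), zero_mul]
  have e2 : ∫ x in (0 : ℝ)..u, min (x - w) 0 * p' x = ∫ x in (0 : ℝ)..u, (x - u) * p' x := by
    apply intervalIntegral.integral_congr
    intro x hx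
    rw [Set.uIcc_of_le hu0] at hx
    simp only
    rw [huw x ⟨hx.1, hx.2.trans hu1⟩, min_eq_left (by linarith [hx.2])]
  rw [e1, e2, intervalIntegral.integral_mul_deriv_eq_deriv_mul (u := fun x => x - u)
    (u' := fun _ => 1) (v := p) (fun x _ => (hasDerivAt_id x).sub_const u) (fun x _ => hp x)
    (by simp) (hp'.intervalIntegrable _ _), huw 0 (by simp), min_eq_left (by linarith)]
  simp

/-- The Vysochanskij–Petunin inequality for a unimodal density on `[0, 1]`. -/
theorem integral_tails_le_of_unimodal {p p' : ℝ → ℝ} (hp : ∀ x, HasDerivAt p (p' x) x)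
    (hp' : Continuous p') (hp0 : 0 ≤ p 0) (hp1 : 0 ≤ p 1) {ν : ℝ} (hν0 : 0 ≤ ν) (hν1 : ν ≤ 1)
    (hmode : ∀ x ∈ Set.Icc (0 : ℝ) 1, (x - ν) * p' x ≤ 0)
    (hone : ∫ x in (0 : ℝ)..1, p x = 1) {α r τ : ℝ} (hα0 : 0 ≤ α) (hα1 : α ≤ 1) (hr : 0 < r)
    (hτ : ∫ x in (0 : ℝ)..1, (x - α) ^ 2 * p x = τ * r ^ 2) (hτ0 : 0 ≤ τ) (hτ1 : τ ≤ 3 / 8) :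
    (∫ x in (0 : ℝ)..max (α - r) 0, p x) + ∫ x in min (α + r) 1..1, p x ≤ 4 / 9 * τ := by
  obtain ⟨A, b, hAb, hK⟩ := exists_quadratic_majorant ((ν - α) / r)
  have hpc : Continuous p := continuous_iff_continuousAt.2 fun x => (hp x).continuousAt
  -- `H` is a primitive of the rescaled quadratic minus the tail indicator, normalised by `c` to
  -- vanish at the mode. The majorant property says that `H x` has the sign of `x - ν`, opposite to
  -- that of `p'`.
  set c : ℝ := A * (((ν - α) / r) ^ 3 / 3 - b * ((ν - α) / r)) - excess ((ν - α) / r) with hc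
  set C : ℝ → ℝ := fun x => A * ((x - α) ^ 3 / (3 * r ^ 2) - b * (x - α)) - r * c with hC
  set H : ℝ → ℝ := fun x => C x - max (x - (α + r)) 0 - min (x - (α - r)) 0 with hH
  have hex : ∀ x, r * excess ((x - α) / r) = max (x - (α + r)) 0 + min (x - (α - r)) 0 := by
    intro x
    rw [excess, mul_add, mul_max_of_nonneg _ _ hr.le, mul_min_of_nonneg _ _ hr.le]
    congr 2 <;> field_simp <;> ring
  have hHK : ∀ x, 0 ≤ (x - ν) * H x := by
    intro x
    have h := mul_nonneg (sq_nonneg r) (hK ((x - α) / r))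
    have e : H x = C x - r * excess ((x - α) / r) := by rw [hex, hH]; ring
    rw [e]
    refine h.trans_eq ?_
    simp only [hC, hc]
    field_simp
    ring
  have hHν : H ν = 0 := by
    have e : H ν = C ν - r * excess ((ν - α) / r) := by rw [hex, hH]; ring
    rw [e]
    simp only [hC, hc]
    field_simp
    ring
  have hHp : ∀ x ∈ Set.Icc (0 : ℝ) 1, H x * p' x ≤ 0 := by
    intro x hx
    rcases eq_or_ne x ν with rfl | hne
    · simp [hHν]
    · have h1 := mul_nonpos_of_nonneg_of_nonpos (hHK x) (hmode x hx)
      have h2 : 0 < (x - ν) ^ 2 := by have := sub_ne_zero.2 hne; positivity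
      by_contra! hcon
      nlinarith [mul_pos h2 hcon]
  have hint : ∫ x in (0 : ℝ)..1, H x * p' x ≤ 0 := by
    have : 0 ≤ ∫ x in (0 : ℝ)..1, -(H x * p' x) :=
      intervalIntegral.integral_nonneg zero_le_one fun x hx => neg_nonneg.2 (hHp x hx)
    rw [intervalIntegral.integral_neg] at this
    linarith
  have hCd : ∀ x, HasDerivAt C (A * ((x - α) ^ 2 / r ^ 2 - b)) x := by
    intro x
    have h := (hasDerivAt_id x).sub_const α
    have := ((((h.pow 3).div_const (3 * r ^ 2)).sub (h.const_mul b)).const_mul A).sub_const (r * c)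
    refine this.congr_deriv ?_
    simp only [id]
    field_simp
    push_cast
    ring
  have hCc : Continuous C := by fun_prop
  have hsplit : ∫ x in (0 : ℝ)..1, H x * p' x = (∫ x in (0 : ℝ)..1, C x * p' x)
      - (∫ x in (0 : ℝ)..1, max (x - (α + r)) 0 * p' x)
      - ∫ x in (0 : ℝ)..1, min (x - (α - r)) 0 * p' x := by
    rw [← intervalIntegral.integral_sub, ← intervalIntegral.integral_sub]
    · simp only [hH, sub_mul]
    all_goals exact Continuous.intervalIntegrable (by fun_prop) _ _
  have hCp : ∫ x in (0 : ℝ)..1, C x * p' x = C 1 * p 1 - C 0 * p 0 - A * (τ - b) := by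
    rw [intervalIntegral.integral_mul_deriv_eq_deriv_mul (fun x _ => hCd x) (fun x _ => hp x)
      (Continuous.intervalIntegrable (by fun_prop) _ _) (hp'.intervalIntegrable _ _)]
    congr 1
    have e : ∀ x, A * ((x - α) ^ 2 / r ^ 2 - b) * p x
        = A / r ^ 2 * ((x - α) ^ 2 * p x) - A * b * p x := fun x => by ring
    simp only [e]
    rw [intervalIntegral.integral_sub, intervalIntegral.integral_const_mul,
      intervalIntegral.integral_const_mul, hτ, hone]
    · field_simp
    all_goals exact Continuous.intervalIntegrable (by fun_prop) _ _
  rw [hsplit, hCp,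
    integral_max_sub_mul_deriv hp hp' (v := min (α + r) 1) (le_min (by linarith) zero_le_one)
      (min_le_right _ _) ?_,
    integral_min_sub_mul_deriv hp hp' (u := max (α - r) 0) (le_max_right _ _)
      (max_le (by linarith) zero_le_one) ?_] at hint
  -- The sign of `H` also settles the boundary terms; at an endpoint that is itself the mode, `H`
  -- vanishes.
  · have h1 : 0 ≤ H 1 * p 1 := by
      rcases eq_or_lt_of_le hν1 with rfl | h
      · simp [hHν]
      · exact mul_nonneg (nonneg_of_mul_nonneg_right (hHK 1) (by linarith)) hp1
    have h0 : H 0 * p 0 ≤ 0 := by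
      rcases eq_or_lt_of_le hν0 with rfl | h
      · simp [hHν]
      · exact mul_nonpos_of_nonpos_of_nonneg (by nlinarith [hHK 0]) hp0
    have h0' : max (0 - (α + r)) 0 = 0 := max_eq_right (by linarith)
    have h1' : min (1 - (α - r)) 0 = 0 := min_eq_right (by linarith)
    simp only [hH, h0', h1'] at h0 h1
    linarith [hAb τ hτ0 hτ1]
  · intro x hx
    rcases le_total (α - r) 0 with h | h
    · rw [max_eq_right h, min_eq_right (by linarith [hx.1]), min_eq_right (by linarith [hx.1])]
    · rw [max_eq_left h]
  · intro x hx
    rcases le_total (α + r) 1 with h | h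
    · rw [min_eq_left h]
    · rw [min_eq_right h, max_eq_right (by linarith [hx.2]), max_eq_right (by linarith [hx.2])]

/-! ### Beta densities and binomial tails -/

/-- The density of the `(a + 1)`-st order statistic of `a + c + 1` uniform samples. -/
noncomputable def betaDensity (a c : ℕ) (x : ℝ) : ℝ :=
  ((a + c + 1 : ℕ) : ℝ) * ((a + c).choose a : ℝ) * (x ^ a * (1 - x) ^ c)

/-- The probability of at least `m` successes in `N` trials with success probability `t`. -/
noncomputable def binomialTail (N m : ℕ) (t : ℝ) : ℝ :=
  ∑ j ∈ Finset.Ico m (N + 1), (N.choose j : ℝ) * (t ^ j * (1 - t) ^ (N - j))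

lemma continuous_betaDensity (a c : ℕ) : Continuous (betaDensity a c) := by
  unfold betaDensity; fun_prop

/-- Derivatives of Bernstein polynomials are differences of those one degree lower, so the sum
telescopes; the upper end vanishes since its index exceeds the degree. -/
lemma hasDerivAt_binomialTail (a c : ℕ) (t : ℝ) :
    HasDerivAt (binomialTail (a + c + 1) (a + 1)) (betaDensity a c t) t := by
  have h1 : binomialTail (a + c + 1) (a + 1) = fun t =>
      (∑ i ∈ Finset.range (c + 1), bernsteinPolynomial ℝ (a + c + 1) (a + i + 1)).eval t := by
    ext t
    rw [binomialTail, Finset.sum_Ico_eq_sum_range, Polynomial.eval_finsetSum]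
    have : a + c + 1 + 1 - (a + 1) = c + 1 := by omega
    rw [this]
    refine Finset.sum_congr rfl fun i _ => ?_
    rw [show a + 1 + i = a + i + 1 by ring]
    simp [bernsteinPolynomial, mul_assoc]
  rw [h1]
  refine (Polynomial.hasDerivAt _ t).congr_deriv ?_
  have h2 : ∀ i ∈ Finset.range (c + 1),
      Polynomial.derivative (bernsteinPolynomial ℝ (a + c + 1) (a + i + 1)) =
      -(((a + c + 1 : ℕ) : Polynomial ℝ) * (bernsteinPolynomial ℝ (a + c) (a + (i + 1))
        - bernsteinPolynomial ℝ (a + c) (a + i))) := by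
    intro i _
    rw [bernsteinPolynomial.derivative_succ, Nat.add_sub_cancel]
    ring_nf
  rw [Polynomial.derivative_sum, Finset.sum_congr rfl h2, Finset.sum_neg_distrib,
    ← Finset.mul_sum, Finset.sum_range_sub (fun i => bernsteinPolynomial ℝ (a + c) (a + i)),
    bernsteinPolynomial.eq_zero_of_lt ℝ (show a + c < a + (c + 1) by omega)]
  simp [betaDensity, bernsteinPolynomial, mul_assoc]

lemma binomialTail_zero (N m : ℕ) : binomialTail N (m + 1) 0 = 0 := by
  refine Finset.sum_eq_zero fun j hj => ?_
  have : j ≠ 0 := by have := (Finset.mem_Ico.1 hj).1; omega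
  simp [this]

lemma binomialTail_one {N m : ℕ} (h : m ≤ N) : binomialTail N m 1 = 1 := by
  rw [binomialTail, Finset.sum_eq_single N]
  · simp
  · intro j hj hne
    have : N - j ≠ 0 := by have := (Finset.mem_Ico.1 hj).2; omega
    simp [this]
  · intro hN; exact absurd (Finset.mem_Ico.2 ⟨h, by omega⟩) hN

lemma integral_betaDensity_eq_sub (a c : ℕ) (s t : ℝ) :
    ∫ x in s..t, betaDensity a c x
      = binomialTail (a + c + 1) (a + 1) t - binomialTail (a + c + 1) (a + 1) s :=
  intervalIntegral.integral_eq_sub_of_hasDerivAt (fun x _ => hasDerivAt_binomialTail a c x)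
    ((continuous_betaDensity a c).intervalIntegrable _ _)

lemma integral_betaDensity (a c : ℕ) : ∫ x in (0 : ℝ)..1, betaDensity a c x = 1 := by
  rw [integral_betaDensity_eq_sub, binomialTail_zero, binomialTail_one (by omega), sub_zero]

/-- Multiplying by `x` only shifts the parameter, so all moments follow from the total mass. -/
lemma mul_betaDensity (a c : ℕ) (x : ℝ) :
    x * betaDensity a c x = (a + 1) / (a + c + 2) * betaDensity (a + 1) c x := by
  have h := Nat.add_one_mul_choose_eq (a + c) a
  have h' : ((a + c + 1 : ℝ)) * ((a + c).choose a : ℝ)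
      = ((a + c + 1).choose (a + 1) : ℝ) * (a + 1) := by exact_mod_cast h
  have e : a + 1 + c = a + c + 1 := by ring
  have hne : (a : ℝ) + c + 2 ≠ 0 := by positivity
  unfold betaDensity
  rw [e]
  push_cast
  rw [h']
  field_simp
  ring

lemma integral_mul_betaDensity (a c : ℕ) :
    ∫ x in (0 : ℝ)..1, x * betaDensity a c x = (a + 1) / (a + c + 2) := by
  simp only [mul_betaDensity]
  rw [intervalIntegral.integral_const_mul, integral_betaDensity, mul_one]

lemma integral_sq_mul_betaDensity (a c : ℕ) :
    ∫ x in (0 : ℝ)..1, x * (x * betaDensity a c x)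
      = (a + 1) / (a + c + 2) * ((a + 2) / (a + c + 3)) := by
  have e : ∀ x, x * (x * betaDensity a c x)
      = (a + 1) / (a + c + 2) * (x * betaDensity (a + 1) c x) := fun x => by
    rw [mul_betaDensity]; ring
  simp only [e]
  rw [intervalIntegral.integral_const_mul, integral_mul_betaDensity]
  push_cast
  ring_nf

/-- The variance of the beta distribution. -/
lemma integral_sub_mean_sq_mul_betaDensity (a c : ℕ) {γ : ℝ}
    (hγ : γ = (a + 1) / (a + c + 2)) :
    ∫ x in (0 : ℝ)..1, (x - γ) ^ 2 * betaDensity a c x = γ * (1 - γ) / (a + c + 3) := by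
  have hc := continuous_betaDensity a c
  have e : ∀ x, (x - γ) ^ 2 * betaDensity a c x = x * (x * betaDensity a c x)
      - 2 * γ * (x * betaDensity a c x) + γ ^ 2 * betaDensity a c x := fun x => by ring
  simp only [e]
  rw [intervalIntegral.integral_add, intervalIntegral.integral_sub,
    intervalIntegral.integral_const_mul, intervalIntegral.integral_const_mul,
    integral_sq_mul_betaDensity, integral_mul_betaDensity, integral_betaDensity, hγ]
  · have h2 : (a : ℝ) + c + 2 ≠ 0 := by positivity
    have h3 : (a : ℝ) + c + 3 ≠ 0 := by positivity
    field_simp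
    ring
  all_goals exact Continuous.intervalIntegrable (by fun_prop) _ _

/-- The derivative of `betaDensity a c`. -/
noncomputable def betaDensityDeriv (a c : ℕ) (x : ℝ) : ℝ :=
  ((a + c + 1 : ℕ) : ℝ) * ((a + c).choose a : ℝ) *
    (a * x ^ (a - 1) * (1 - x) ^ c - x ^ a * (c * (1 - x) ^ (c - 1)))

lemma hasDerivAt_betaDensity (a c : ℕ) (x : ℝ) :
    HasDerivAt (betaDensity a c) (betaDensityDeriv a c x) x := by
  have h1 := hasDerivAt_pow a x
  have h2 := ((hasDerivAt_id x).const_sub 1).pow c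
  refine ((h1.mul h2).const_mul (((a + c + 1 : ℕ) : ℝ) * ((a + c).choose a : ℝ))).congr_deriv ?_
  simp only [betaDensityDeriv, id, Pi.pow_apply]
  ring

lemma exists_mode_betaDensity (a c : ℕ) : ∃ ν : ℝ, 0 ≤ ν ∧ ν ≤ 1 ∧
    ∀ x ∈ Set.Icc (0 : ℝ) 1, (x - ν) * betaDensityDeriv a c x ≤ 0 := by
  -- For `a = c = 0` the quotient is `0` by convention, which is harmless: the density is constant.
  refine ⟨a / (a + c), by positivity, div_le_one_of_le₀ (by simp) (by positivity), ?_⟩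
  intro x ⟨hx0, hx1⟩
  have hx1' : 0 ≤ 1 - x := by linarith
  have key : ((a : ℝ) + c) * x - a = (x - a / (a + c)) * (a + c) := by
    rcases eq_or_ne ((a : ℝ) + c) 0 with h | h
    · have : (a : ℝ) = 0 := by
        have := Nat.cast_nonneg (α := ℝ) a; have := Nat.cast_nonneg (α := ℝ) c; linarith
      simp [this, mul_comm]
    · field_simp
  have main : (x - a / (a + c)) *
      (a * x ^ (a - 1) * (1 - x) ^ c - x ^ a * (c * (1 - x) ^ (c - 1))) ≤ 0 := by
    rcases a with _ | a <;> rcases c with _ | c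
    · simp
    · simp
      positivity
    · simp at key ⊢
      rw [div_self (by positivity)]
      apply mul_nonpos_of_nonpos_of_nonneg (by linarith)
      positivity
    · have e : ((a + 1 : ℕ) : ℝ) * x ^ (a + 1 - 1) * (1 - x) ^ (c + 1)
          - x ^ (a + 1) * (((c + 1 : ℕ) : ℝ) * (1 - x) ^ (c + 1 - 1))
          = -(x ^ a * (1 - x) ^ c * ((((a + 1 : ℕ) : ℝ) + ((c + 1 : ℕ) : ℝ)) * x
            - ((a + 1 : ℕ) : ℝ))) := by
        simp only [Nat.add_sub_cancel]; ring
      rw [e, key]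
      have : ∀ d P s : ℝ, d * -(P * (d * s)) = -(d ^ 2 * P * s) := fun d P s => by ring
      rw [this]
      exact neg_nonpos.2 (by positivity)
  unfold betaDensityDeriv
  rw [mul_left_comm]
  exact mul_nonpos_of_nonneg_of_nonpos (by positivity) main

/-! ### Order statistics of i.i.d. samples -/

lemma orderStatistic_le_iff {N : ℕ} (x : Fin N → ℝ) {m : ℕ} (h1 : 1 ≤ m) (hN : m ≤ N) (s : ℝ) :
    orderStatistic x m ≤ s ↔ m ≤ (Finset.univ.filter fun i => x i ≤ s).card := by
  rw [orderStatistic, dif_pos ⟨h1, hN⟩]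
  have h := Tuple.lt_card_le_iff_apply_le_of_monotone (f := x ∘ Tuple.sort x) (a := s)
    (j := ⟨m - 1, by omega⟩) (Tuple.monotone_sort x)
  have hcard : (Finset.univ.filter fun i => (x ∘ Tuple.sort x) i ≤ s).card
      = (Finset.univ.filter fun i => x i ≤ s).card := by
    refine Finset.card_bij (fun i _ => Tuple.sort x i) (by simp) (by simp) ?_
    intro b hb
    exact ⟨(Tuple.sort x).symm b, by simpa using hb, by simp⟩
  rw [hcard] at h
  rw [Function.comp_apply] at h
  rw [← h]
  simp only
  omega

lemma cdf_map_eq_real {Ω₀ : Type*} [MeasurableSpace Ω₀] {P₀ : Measure Ω₀}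
    [IsProbabilityMeasure P₀] {y : Ω₀ → ℝ} (hy : AEMeasurable y P₀) (s : ℝ) :
    cdf (P₀.map y) s = P₀.real (y ⁻¹' Set.Iic s) := by
  have := Measure.isProbabilityMeasure_map hy
  rw [cdf_eq_real, map_measureReal_apply_of_aemeasurable hy measurableSet_Iic]

section Sample

variable {Ω₀ Ω : Type*} [MeasurableSpace Ω₀] [MeasurableSpace Ω] {P₀ : Measure Ω₀}
  [IsProbabilityMeasure P₀] {y : Ω₀ → ℝ} {P : Measure Ω} {N : ℕ}
  {Y : Fin N → Ω → ℝ}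

/-- The probability that exactly the samples indexed by `S` are at most `s`. -/
lemma IsIIDSample.real_filter_le_eq (hY : IsIIDSample P₀ y P Y) (hy : AEMeasurable y P₀)
    (s : ℝ) (S : Finset (Fin N)) :
    P.real {ω | (Finset.univ.filter fun i => Y i ω ≤ s) = S}
      = cdf (P₀.map y) s ^ S.card * (1 - cdf (P₀.map y) s) ^ (N - S.card) := by
  have hset : {ω | (Finset.univ.filter fun i => Y i ω ≤ s) = S}
      = ⋂ i ∈ (Finset.univ : Finset (Fin N)),
        Y i ⁻¹' (if i ∈ S then Set.Iic s else (Set.Iic s)ᶜ) := by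
    ext ω
    simp only [Set.mem_ofPred_eq, Finset.ext_iff, Finset.mem_filter, Finset.mem_univ, true_and,
      Set.iInter_true, Set.mem_iInter, Set.mem_preimage]
    refine forall_congr' fun i => ?_
    split_ifs with h <;> simp [h]
  have hprob := Measure.isProbabilityMeasure_map hy
  have hfac : ∀ i, P.real (Y i ⁻¹' (if i ∈ S then Set.Iic s else (Set.Iic s)ᶜ))
      = if i ∈ S then cdf (P₀.map y) s else 1 - cdf (P₀.map y) s := by
    intro i
    have hm : ∀ A, MeasurableSet A → P.real (Y i ⁻¹' A) = (P₀.map y).real A := by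
      intro A hA
      rw [map_measureReal_apply_of_aemeasurable hy hA, measureReal_def, measureReal_def,
        (hY.identDistrib i).measure_preimage_eq hA]
    split_ifs
    · rw [hm _ measurableSet_Iic, cdf_eq_real]
    · rw [hm _ measurableSet_Iic.compl, cdf_eq_real, probReal_compl_eq_one_sub measurableSet_Iic]
  rw [hset, measureReal_def, hY.indep.measure_inter_preimage_eq_mul Finset.univ
    (by intro i _; split_ifs <;> measurability), ENNReal.toReal_prod]
  simp only [← measureReal_def, hfac]
  rw [Finset.prod_ite]
  simp only [Finset.prod_const]
  congr 2
  · simp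
  · rw [Finset.filter_not, Finset.card_sdiff_of_subset (Finset.filter_subset _ _)]
    simp

variable [IsProbabilityMeasure P]

/-- An upper bound is enough for both tails, so subadditivity over the possible index sets suffices,
without measurability of the counting event. -/
lemma IsIIDSample.real_card_mem_le (hY : IsIIDSample P₀ y P Y) (hy : AEMeasurable y P₀)
    (s : ℝ) (J : Finset ℕ) :
    P.real {ω | (Finset.univ.filter fun i => Y i ω ≤ s).card ∈ J}
      ≤ ∑ j ∈ J, (N.choose j : ℝ) *
        (cdf (P₀.map y) s ^ j * (1 - cdf (P₀.map y) s) ^ (N - j)) := by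
  have hsub : {ω | (Finset.univ.filter fun i => Y i ω ≤ s).card ∈ J}
      ⊆ ⋃ S ∈ J.biUnion fun j => (Finset.univ : Finset (Fin N)).powersetCard j,
        {ω | (Finset.univ.filter fun i => Y i ω ≤ s) = S} := by
    intro ω hω
    simpa using hω
  refine (measureReal_mono hsub (measure_ne_top _ _)).trans ((measureReal_biUnion_finset_le _ _).trans_eq ?_)
  rw [Finset.sum_biUnion]
  · refine Finset.sum_congr rfl fun j _ => ?_
    rw [Finset.sum_congr rfl (g := fun _ =>
      cdf (P₀.map y) s ^ j * (1 - cdf (P₀.map y) s) ^ (N - j))]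
    · simp
    · intro S hS
      rw [hY.real_filter_le_eq hy, (Finset.mem_powersetCard.1 hS).2]
  · intro i _ j _ hij
    exact Finset.pairwise_disjoint_powersetCard _ hij

lemma IsIIDSample.real_orderStatistic_le (hY : IsIIDSample P₀ y P Y) (hy : AEMeasurable y P₀)
    {m : ℕ} (h1 : 1 ≤ m) (hN : m ≤ N) (s : ℝ) :
    P.real {ω | orderStatistic (fun i => Y i ω) m ≤ s} ≤ binomialTail N m (cdf (P₀.map y) s) := by
  refine le_trans (measureReal_mono fun ω hω => ?_)
    (hY.real_card_mem_le hy s (Finset.Ico m (N + 1)))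
  · have hc := Finset.card_le_univ (Finset.univ.filter fun i => Y i ω ≤ s)
    rw [Fintype.card_fin] at hc
    have := (orderStatistic_le_iff _ h1 hN s).1 hω
    simp only [Set.mem_ofPred_eq, Finset.mem_Ico]
    omega

lemma IsIIDSample.real_lt_orderStatistic (hY : IsIIDSample P₀ y P Y) (hy : AEMeasurable y P₀)
    {m : ℕ} (h1 : 1 ≤ m) (hN : m ≤ N) (s : ℝ) :
    P.real {ω | s < orderStatistic (fun i => Y i ω) m}
      ≤ 1 - binomialTail N m (cdf (P₀.map y) s) := by
  refine le_trans (measureReal_mono fun ω hω => ?_)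
    ((hY.real_card_mem_le hy s (Finset.range m)).trans_eq ?_)
  · have := (orderStatistic_le_iff (fun i => Y i ω) h1 hN s).not.1 (not_le.2 hω)
    simp only [Set.mem_ofPred_eq, Finset.mem_range]
    omega
  · set t := cdf (P₀.map y) s
    rw [eq_sub_iff_add_eq, binomialTail, Finset.sum_range_add_sum_Ico _ (by omega)]
    have := add_pow t (1 - t) N
    rw [add_sub_cancel, one_pow] at this
    refine Eq.trans ?_ this.symm
    exact Finset.sum_congr rfl fun j _ => by ring

end Sample

/-! ### Coverage of the quantile level -/

lemma exists_cdf_eq {μ : Measure ℝ} (hc : Continuous fun x => cdf μ x) {t : ℝ} (h0 : 0 < t)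
    (h1 : t < 1) : ∃ s, cdf μ s = t := by
  obtain ⟨a, ha⟩ := ((tendsto_cdf_atBot μ).eventually (gt_mem_nhds h0)).exists
  obtain ⟨b, hb⟩ := ((tendsto_cdf_atTop μ).eventually (lt_mem_nhds h1)).exists
  exact mem_range_of_exists_le_of_exists_ge hc ⟨a, ha.le⟩ ⟨b, hb.le⟩

/-- The quantile level of an order statistic leaves `[γ - ε, γ + ε]` with at most the
probability of the corresponding binomial tails. -/
lemma IsIIDSample.one_sub_tails_le {Ω₀ Ω : Type*} [MeasurableSpace Ω₀] [MeasurableSpace Ω]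
    {P₀ : Measure Ω₀} [IsProbabilityMeasure P₀] {y : Ω₀ → ℝ} {P : Measure Ω}
    [IsProbabilityMeasure P] {N : ℕ} {Y : Fin N → Ω → ℝ} (hY : IsIIDSample P₀ y P Y)
    (hy : AEMeasurable y P₀) (hc : Continuous fun x => cdf (P₀.map y) x)
    {m : ℕ} (hN : m + 1 ≤ N) {γ ε : ℝ} (hγ0 : 0 < γ) (hγ1 : γ < 1) (hε : 0 < ε) :
    1 - (binomialTail N (m + 1) (max (γ - ε) 0) + (1 - binomialTail N (m + 1) (min (γ + ε) 1)))
      ≤ P.real {ω | |cdf (P₀.map y) (orderStatistic (fun i => Y i ω) (m + 1)) - γ| ≤ ε} := by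
  set F := cdf (P₀.map y)
  set T : Ω → ℝ := fun ω => orderStatistic (fun i => Y i ω) (m + 1)
  have hlow : P.real {ω | F (T ω) < γ - ε} ≤ binomialTail N (m + 1) (max (γ - ε) 0) := by
    -- The level `0` need not be attained by the distribution function, but then the event is empty.
    rcases le_or_gt (γ - ε) 0 with h | h
    · have : {ω | F (T ω) < γ - ε} = ∅ := by
        ext ω
        simpa using h.trans (cdf_nonneg _ _)
      rw [this, max_eq_right h, binomialTail_zero, measureReal_empty]
    · obtain ⟨s, hs⟩ := exists_cdf_eq hc h (by linarith)
      rw [max_eq_left h.le, ← hs]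
      refine (measureReal_mono fun ω hω => ?_).trans
        (hY.real_orderStatistic_le hy (by omega) hN s)
      by_contra hlt
      exact absurd (monotone_cdf (P₀.map y) (not_le.1 hlt).le) (not_le.2 hω)
  have hhigh : P.real {ω | γ + ε < F (T ω)} ≤ 1 - binomialTail N (m + 1) (min (γ + ε) 1) := by
    rcases le_or_gt 1 (γ + ε) with h | h
    · have : {ω | γ + ε < F (T ω)} = ∅ := by
        ext ω
        simpa using (cdf_le_one _ _).trans h
      rw [this, min_eq_right h, binomialTail_one hN, measureReal_empty, sub_self]
    · obtain ⟨s, hs⟩ := exists_cdf_eq hc (show 0 < γ + ε by linarith) h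
      rw [min_eq_left h.le, ← hs]
      refine (measureReal_mono fun ω hω => ?_).trans
        (hY.real_lt_orderStatistic hy (by omega) hN s)
      by_contra hlt
      exact absurd (monotone_cdf (P₀.map y) (not_lt.1 hlt)) (not_le.2 hω)
  -- Covering the whole space and using subadditivity avoids taking the complement of a possibly
  -- nonmeasurable event.
  have hcover : (Set.univ : Set Ω) ⊆
      {ω | |F (T ω) - γ| ≤ ε} ∪ ({ω | F (T ω) < γ - ε} ∪ {ω | γ + ε < F (T ω)}) := by
    intro ω _
    simp only [Set.mem_union, Set.mem_ofPred_eq, abs_le]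
    by_contra! hcon
    linarith [hcon.1 (by linarith [hcon.2.1]), hcon.2.2]
  have htot := measureReal_mono (μ := P) hcover
  rw [probReal_univ] at htot
  have h1 := measureReal_union_le (μ := P) {ω | |F (T ω) - γ| ≤ ε}
    ({ω | F (T ω) < γ - ε} ∪ {ω | γ + ε < F (T ω)})
  have h2 := measureReal_union_le (μ := P) {ω | F (T ω) < γ - ε} {ω | γ + ε < F (T ω)}
  linarith

/-! ### Choice of the sample size -/

theorem mainTheorem1
    (γ ε ρ : ℝ) (n₁ n₂ : ℤ)
    (hγ0 : 0 < γ) (hγ1 : γ < 1)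
    (hε0 : 0 < ε) (hε1 : ε < 1)
    (hρ0 : 0 < ρ) (hρ1 : ρ < 1)
    (hn₂ : 0 < n₂) (hcop : IsCoprime n₁ n₂) (hγ : γ = (n₁ : ℝ) / (n₂ : ℝ))
    (hcond : 9 * ρ * ε ^ 2 < 4 * γ * (1 - γ)) (hρ6 : 6 * ρ ≤ 1)
    (k : ℤ)
    (hk : k = ⌈(1 / (n₂ : ℝ)) * (4 * γ * (1 - γ) / (9 * ρ * ε ^ 2) - 1)⌉) :
    1 ≤ k ∧
    ∃ N : ℕ, (N : ℤ) = k * n₂ - 1 ∧ ⌊(N : ℝ) * γ⌋₊ + 1 ≤ N ∧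
      ∀ (Ω₀ : Type*) [MeasurableSpace Ω₀] (P₀ : Measure Ω₀) [IsProbabilityMeasure P₀]
        (yD : Ω₀ → ℝ) (_ : AEMeasurable yD P₀)
        (_ : Continuous (fun x : ℝ => cdf (P₀.map yD) x))
        (Ω : Type*) [MeasurableSpace Ω] (P : Measure Ω) [IsProbabilityMeasure P]
        (Y : Fin N → Ω → ℝ) (_ : IsIIDSample P₀ yD P Y),
        1 - ρ ≤ P.real {ω |
          |cdf (P₀.map yD)
              (orderStatistic (fun i => Y i ω) (⌊(N : ℝ) * γ⌋₊ + 1)) - γ| ≤ ε} := by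
  have hn₂' : (0 : ℝ) < n₂ := by exact_mod_cast hn₂
  have hd : 0 < 9 * ρ * ε ^ 2 := by positivity
  have hγn : γ * n₂ = n₁ := by rw [hγ]; field_simp
  have hn₁ : 0 < n₁ := by
    have : (0 : ℝ) < n₁ := hγn ▸ mul_pos hγ0 hn₂'
    exact_mod_cast this
  have hn₁₂ : n₁ < n₂ := by
    have : (n₁ : ℝ) < n₂ := by rw [← hγn]; nlinarith
    exact_mod_cast this
  have hk1 : 1 ≤ k := by
    rw [hk, Int.one_le_ceil_iff]
    exact mul_pos (by positivity) (sub_pos.2 ((one_lt_div hd).2 hcond))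
  refine ⟨hk1, ?_⟩
  -- Taking `a + 1 = k * n₁` and `c + 1 = k * (n₂ - n₁)` makes the beta mean `n₁ / n₂ = γ`. Then `N
  -- * γ = a + 1 - γ`, whose floor is `a`.
  obtain ⟨a, ha⟩ := Int.eq_ofNat_of_zero_le (show 0 ≤ k * n₁ - 1 by nlinarith)
  obtain ⟨c, hc⟩ := Int.eq_ofNat_of_zero_le (show 0 ≤ k * (n₂ - n₁) - 1 by nlinarith)
  have ha' : (k : ℝ) * n₁ = a + 1 := by
    have : k * n₁ = a + 1 := by linarith
    exact_mod_cast this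
  have hN : ((a + c + 1 : ℕ) : ℤ) = k * n₂ - 1 := by push_cast; linarith
  have hN' : (k : ℝ) * n₂ = a + c + 2 := by
    have : k * n₂ = a + c + 2 := by push_cast at hN; linarith
    exact_mod_cast this
  have hmean : γ * (a + c + 2) = a + 1 := by rw [← hN', ← ha', ← hγn]; ring
  have hfloor : ⌊((a + c + 1 : ℕ) : ℝ) * γ⌋₊ = a := by
    rw [Nat.floor_eq_iff (by positivity)]
    push_cast
    constructor <;> linarith
  refine ⟨a + c + 1, hN, by rw [hfloor]; omega, ?_⟩
  intro Ω₀ _ P₀ _ yD hy hcont Ω _ P _ Y hY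
  rw [hfloor]
  refine le_trans ?_ (hY.one_sub_tails_le hy hcont (by omega) hγ0 hγ1 hε0)
  obtain ⟨ν, hν0, hν1, hmode⟩ := exists_mode_betaDensity a c
  -- The ceiling defining `k` is exactly the condition that `N + 2 = k * n₂ + 1` be large enough.
  have hsize : 4 * γ * (1 - γ) ≤ 9 * ρ * ε ^ 2 * (a + c + 3) := by
    have h := Int.le_ceil ((1 / (n₂ : ℝ)) * (4 * γ * (1 - γ) / (9 * ρ * ε ^ 2) - 1))
    rw [← hk, one_div_mul_eq_div, div_le_iff₀ hn₂', hN', sub_le_iff_le_add, div_le_iff₀ hd] at h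
    linarith
  have hvar : γ * (1 - γ) / (a + c + 3) / ε ^ 2 ≤ 9 / 4 * ρ := by
    rw [div_div, div_le_iff₀ (by positivity)]
    linarith
  have htails := integral_tails_le_of_unimodal (hasDerivAt_betaDensity a c)
    (p' := betaDensityDeriv a c) (by unfold betaDensityDeriv; fun_prop)
    (by unfold betaDensity; positivity) (by simp [betaDensity]; positivity) hν0 hν1 hmode
    (integral_betaDensity a c) hγ0.le hγ1.le hε0
    (τ := γ * (1 - γ) / (a + c + 3) / ε ^ 2)
    (by
      rw [integral_sub_mean_sq_mul_betaDensity a c (by rw [eq_div_iff (by positivity), hmean])]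
      field_simp)
    (by have := sub_pos.2 hγ1; positivity) (by linarith)
  rw [integral_betaDensity_eq_sub, integral_betaDensity_eq_sub, binomialTail_zero,
    binomialTail_one (by omega)] at htails
  linarith
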